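/- Let $\mathbb D=\{|z|<1\}$ and let $\mathcal B_0$ be the class of holomorphic functions $F$ on $\mathbb D$ with $0<|F|\le 1$. For $F$ holomorphic on $\mathbb D$ let $T_j(F)$ denote its $j$th Taylor coefficient at $0$, and put $M_n(F)=\mathrm{Re}\,T_n(F)$. Let $n\ge 1$ and let $f(z)=e^{g(z)}=\sum_{j\ge 0}a_jz^j$, with $g$ holomorphic on $\mathbb D$, be extremal for $M_n$, that is, $f\in\mathcal B_0$ and $M_n(f)\ge M_n(F)$ for every $F\in\mathcal B_0$. Set \[ P(z)=a_n+2\sum_{j=1}^n a_{n-j}z^j,\qquad Q(z)=T_n(fg)+2\sum_{j=1}^n T_{n-j}(fg)z^j . \] Then, for $z\in\mathbb D$, \[ g(z)=\frac{z^nQ(1/z)-z^n\overline{Q(\overline z)}}{z^nP(1/z)+z^n\overline{P(\overline z)}} \qquad\text{and}\qquad zg'(z)=n-\frac{z^{n-1}P'(1/z)+z^{n+1}\overline{P'(\overline z)}}{z^nP(1/z)+z^n\overline{P(\overline z)}} . \] Here $z^nP(1/z)$, $z^nQ(1/z)$ and $z^{n-1}P'(1/z)$ are polynomials in $z$ (this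 defines them at $z=0$). The common denominator is a polynomial with finitely many zeros that does not vanish at $0$; the formulas hold pointwise at every $z\in\mathbb D$ where it is non-zero, and any zeros of it in $\mathbb D$ are removable singularities of the two right-hand sides, at which the formulas hold in the sense of limits. -/

import Mathlib

open Complex Filter Topology Polynomial
open scoped ComplexConjugate

namespace Krzyz

/-- The open unit disc in the complex plane. -/
def disc : Set ℂ := Metric.ball 0 1

/-- The `j`-th Taylor coefficient of `F` at zero. -/
noncomputable def taylorCoeff (j : ℕ) (F : ℂ → ℂ) : ℂ :=
  iteratedDeriv j F 0 / (j.factorial : ℂ)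

/-- The class of holomorphic functions on the unit disc with `0 < |f| ≤ 1` there. -/
def IsClassB0 (f : ℂ → ℂ) : Prop :=
  DifferentiableOn ℂ f disc ∧ ∀ z ∈ disc, 0 < ‖f z‖ ∧ ‖f z‖ ≤ 1

/-- The functional `f ↦ Re a_n`, where `a_n` is the `n`-th Taylor coefficient of `f`. -/
noncomputable def M (n : ℕ) (f : ℂ → ℂ) : ℝ := (taylorCoeff n f).re

/-- `f` maximizes `M n` over the whole class. -/
def IsExtremal (n : ℕ) (f : ℂ → ℂ) : Prop :=
  IsClassB0 f ∧ ∀ F : ℂ → ℂ, IsClassB0 F → M n F ≤ M n f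

/-- The polynomial `a_n + 2 ∑_{j=1}^n a_{n-j} z^j`, where `a_j` are the Taylor coefficients
of `f`. -/
noncomputable def polyP (n : ℕ) (f : ℂ → ℂ) : ℂ[X] :=
  C (taylorCoeff n f) + 2 * ∑ j ∈ Finset.Icc 1 n, C (taylorCoeff (n - j) f) * X ^ j

/-- The polynomial `T_n(fg) + 2 ∑_{j=1}^n T_{n-j}(fg) z^j`. -/
noncomputable def polyQ (n : ℕ) (f g : ℂ → ℂ) : ℂ[X] :=
  C (taylorCoeff n (fun z => f z * g z)) +
    2 * ∑ j ∈ Finset.Icc 1 n, C (taylorCoeff (n - j) (fun z => f z * g z)) * X ^ j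

/-- The value at `z` of the polynomial `z^m p(1/z)` (for `p` of degree at most `m`), including
its value at `z = 0`. -/
noncomputable def revEval (m : ℕ) (p : ℂ[X]) (z : ℂ) : ℂ := (p.reflect m).eval z

theorem revEval_eq (m : ℕ) (p : ℂ[X]) (hp : p.natDegree ≤ m) (z : ℂ) (hz : z ≠ 0) :
    revEval m p z = z ^ m * p.eval (1 / z) := by
  let _ : Invertible (1 / z) := invertibleOfNonzero (one_div_ne_zero hz)
  have h := Polynomial.eval₂_reflect_mul_pow (RingHom.id ℂ) (1 / z) m p hp
  have hi : (⅟(1 / z) : ℂ) = z := by simp [invOf_eq_inv]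
  rw [hi, Polynomial.eval₂_id, Polynomial.eval₂_id] at h
  rw [revEval, ← h, one_div, inv_pow]
  field_simp

/-- The value at `z` of the polynomial whose coefficients are the conjugates of those
of `p`. -/
noncomputable def conjEval (p : ℂ[X]) (z : ℂ) : ℂ := conj (p.eval (conj z))

/-- The common denominator `z^n P(1/z) + z^n conj (P (conj z))`. -/
noncomputable def den (n : ℕ) (f : ℂ → ℂ) (z : ℂ) : ℂ :=
  revEval n (polyP n f) z + z ^ n * conjEval (polyP n f) z

/-- The numerator `z^n Q(1/z) - z^n conj (Q (conj z))`. -/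
noncomputable def numG (n : ℕ) (f g : ℂ → ℂ) (z : ℂ) : ℂ :=
  revEval n (polyQ n f g) z - z ^ n * conjEval (polyQ n f g) z

/-- The numerator `z^(n-1) P'(1/z) + z^(n+1) conj (P' (conj z))`. -/
noncomputable def numDG (n : ℕ) (f : ℂ → ℂ) (z : ℂ) : ℂ :=
  revEval (n - 1) (derivative (polyP n f)) z + z ^ (n + 1) * conjEval (derivative (polyP n f)) z

theorem natDegree_polyP (n : ℕ) (f : ℂ → ℂ) : (polyP n f).natDegree ≤ n := by
  unfold polyP
  rw [Finset.mul_sum]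
  refine Polynomial.natDegree_add_le_of_degree_le (by simp) ?_
  refine Polynomial.natDegree_sum_le_of_forall_le _ _ fun j hj => ?_
  rw [← Polynomial.C_ofNat, ← mul_assoc, ← Polynomial.C_mul]
  exact (Polynomial.natDegree_C_mul_X_pow_le _ _).trans (Finset.mem_Icc.1 hj).2

theorem polyQ_eq (n : ℕ) (f g : ℂ → ℂ) : polyQ n f g = polyP n (fun z => f z * g z) := rfl

theorem den_eq (n : ℕ) (f : ℂ → ℂ) (z : ℂ) (hz : z ≠ 0) :
    den n f z = z ^ n * (polyP n f).eval (1 / z) + z ^ n * conj ((polyP n f).eval (conj z)) := by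
  rw [den, revEval_eq _ _ (natDegree_polyP n f) z hz, conjEval]

theorem numG_eq (n : ℕ) (f g : ℂ → ℂ) (z : ℂ) (hz : z ≠ 0) :
    numG n f g z =
      z ^ n * (polyQ n f g).eval (1 / z) - z ^ n * conj ((polyQ n f g).eval (conj z)) := by
  rw [numG, polyQ_eq, revEval_eq _ _ (natDegree_polyP n _) z hz, conjEval]

theorem numDG_eq (n : ℕ) (f : ℂ → ℂ) (z : ℂ) (hz : z ≠ 0) :
    numDG n f z = z ^ (n - 1) * (derivative (polyP n f)).eval (1 / z) +
      z ^ (n + 1) * conj ((derivative (polyP n f)).eval (conj z)) := by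
  have h : (derivative (polyP n f)).natDegree ≤ n - 1 :=
    (Polynomial.natDegree_derivative_le _).trans (Nat.sub_le_sub_right (natDegree_polyP n f) 1)
  rw [numDG, revEval_eq _ _ h z hz, conjEval]

end Krzyz

namespace Krzyz

/-! Since Re g ≤ 0, the boundary values of 2 Re g form a nonpositive measure; extremality forces it
to live on the zeros of a nonnegative trigonometric polynomial.

Perturbing f to f·exp(εh) gives Re T_n(fh) ≤ 0 for every admissible h
(`IsExtremal.re_taylorCoeff_mul_nonpos`). The choices h = ±g, h = ±i and h = minus a Herglotz kernel
give Re T_n(fg) = 0, a_n real, and Re P ≥ 0 on the unit circle. Hence q(w) = w^(-n) den(w) = 2 Re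
P(conj w) is nonnegative there, and its pairing with 2 Re g has real part 4 Re T_n(fg) = 0.

A nonpositive measure that annihilates q ≥ 0 annihilates every w^k q
(`boundaryPairing_shift_eq_zero`). As zeros of q on the circle are at least double, it also
annihilates every w^k (w q') (`boundaryPairing_shift_euler_eq_zero`). Read on coefficients, these
relations are symmetries under K ↦ 2n - K of the coefficients of den·g and den·zg'. The coefficients
of index at most n are explicit, because den = 2f + O(z^(n+1)) and zf' = f·zg'; the symmetry
supplies the rest and kills those beyond 2n. So both products are polynomials, namely the stated
numerators. No measure is constructed: the pairing is algebraic, and its sign comes from circles of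
radius r → 1. -/

theorem isOpen_disc : IsOpen disc := Metric.isOpen_ball

theorem zero_mem_disc : (0 : ℂ) ∈ disc := Metric.mem_ball_self one_pos

theorem analyticAt_zero {F : ℂ → ℂ} (hF : DifferentiableOn ℂ F disc) : AnalyticAt ℂ F 0 :=
  hF.analyticAt (isOpen_disc.mem_nhds zero_mem_disc)

theorem differentiable_eval (p : ℂ[X]) : Differentiable ℂ fun z => p.eval z := p.differentiable

/-! ### Calculus of Taylor coefficients at 0 -/

theorem taylorCoeff_zero (F : ℂ → ℂ) : taylorCoeff 0 F = F 0 := by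
  simp [taylorCoeff]

theorem taylorCoeff_add (k : ℕ) {F G : ℂ → ℂ} (hF : AnalyticAt ℂ F 0) (hG : AnalyticAt ℂ G 0) :
    taylorCoeff k (fun z => F z + G z) = taylorCoeff k F + taylorCoeff k G := by
  rw [taylorCoeff, iteratedDeriv_fun_add hF.contDiffAt hG.contDiffAt, add_div]
  rfl

theorem taylorCoeff_const_mul (k : ℕ) (c : ℂ) (F : ℂ → ℂ) :
    taylorCoeff k (fun z => c * F z) = c * taylorCoeff k F := by
  rw [taylorCoeff, iteratedDeriv_const_mul_field, mul_div_assoc]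
  rfl

theorem taylorCoeff_mul (k : ℕ) {F G : ℂ → ℂ} (hF : AnalyticAt ℂ F 0) (hG : AnalyticAt ℂ G 0) :
    taylorCoeff k (fun z => F z * G z) =
      ∑ i ∈ Finset.range (k + 1), taylorCoeff i F * taylorCoeff (k - i) G := by
  rw [taylorCoeff, iteratedDeriv_fun_mul hF.contDiffAt hG.contDiffAt, Finset.sum_div]
  refine Finset.sum_congr rfl fun i hi => ?_
  have hik : i ≤ k := by simpa [Nat.lt_succ_iff] using hi
  rw [Nat.cast_choose ℂ hik, taylorCoeff, taylorCoeff]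
  have h1 : (k.factorial : ℂ) ≠ 0 := by exact_mod_cast k.factorial_ne_zero
  field_simp

theorem taylorCoeff_eval (k : ℕ) (p : ℂ[X]) : taylorCoeff k (fun z => p.eval z) = p.coeff k := by
  have h : ∀ k : ℕ, deriv^[k] (fun z => p.eval z) = fun z => (derivative^[k] p).eval z := by
    intro k
    induction k with
    | zero => rfl
    | succ k ih =>
      rw [Function.iterate_succ_apply', ih, Function.iterate_succ_apply']
      funext z
      exact Polynomial.deriv _
  rw [taylorCoeff, iteratedDeriv_eq_iterate, h]
  beta_reduce
  rw [← Polynomial.coeff_zero_eq_eval_zero,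
    Polynomial.coeff_iterate_derivative, zero_add, Nat.descFactorial_self, nsmul_eq_mul]
  exact mul_div_cancel_left₀ _ (by exact_mod_cast k.factorial_ne_zero)

theorem taylorCoeff_succ_id_mul (k : ℕ) {F : ℂ → ℂ} (hF : AnalyticAt ℂ F 0) :
    taylorCoeff (k + 1) (fun z => z * F z) = taylorCoeff k F := by
  have hX := fun i => taylorCoeff_eval i (X : ℂ[X])
  simp only [eval_X] at hX
  rw [taylorCoeff_mul (F := fun z => z) (k + 1) analyticAt_id hF, Finset.sum_eq_single 1]
  · rw [hX, coeff_X_one, one_mul, Nat.add_sub_cancel]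
  · intro i _ hi
    rw [hX, coeff_X_of_ne_one hi, zero_mul]
  · intro h
    simp at h

theorem taylorCoeff_id_mul_deriv (k : ℕ) {F : ℂ → ℂ} (hF : AnalyticAt ℂ F 0) :
    taylorCoeff k (fun z => z * deriv F z) = k * taylorCoeff k F := by
  cases k with
  | zero => simp [taylorCoeff_zero]
  | succ k =>
    rw [taylorCoeff_succ_id_mul k hF.deriv, taylorCoeff, taylorCoeff, ← iteratedDeriv_succ',
      Nat.factorial_succ]
    have h1 : (k.factorial : ℂ) ≠ 0 := by exact_mod_cast k.factorial_ne_zero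
    have h2 : ((k : ℂ) + 1) ≠ 0 := by exact_mod_cast k.succ_ne_zero
    push_cast
    field_simp

theorem eqOn_of_taylorCoeff_eq {F G : ℂ → ℂ} (hF : DifferentiableOn ℂ F disc)
    (hG : DifferentiableOn ℂ G disc) (h : ∀ k, taylorCoeff k F = taylorCoeff k G) :
    ∀ z ∈ disc, F z = G z := by
  intro z hz
  have h1 := Complex.hasSum_taylorSeries_on_ball hF hz
  have h2 := Complex.hasSum_taylorSeries_on_ball hG hz
  refine h1.unique ?_
  convert h2 using 2 with k
  have := h k
  rw [taylorCoeff, taylorCoeff, div_left_inj' (by exact_mod_cast k.factorial_ne_zero)] at this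
  rw [this]

/-! ### Fourier coefficients on circles and the pairing with 2 Re g -/

/-- The Taylor coefficients at zero, extended by zero to negative indices. -/
noncomputable def laurentCoeff (F : ℂ → ℂ) (l : ℤ) : ℂ :=
  if 0 ≤ l then taylorCoeff l.toNat F else 0

@[simp] theorem laurentCoeff_natCast (F : ℂ → ℂ) (k : ℕ) :
    laurentCoeff F k = taylorCoeff k F := by simp [laurentCoeff]

theorem laurentCoeff_of_neg (F : ℂ → ℂ) {l : ℤ} (hl : l < 0) : laurentCoeff F l = 0 :=
  if_neg (not_le.2 hl)

theorem circleAverage_mul_zpow {F : ℂ → ℂ} (hF : DifferentiableOn ℂ F disc) {r : ℝ} (h0 : 0 < r)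
    (h1 : r < 1) (l : ℤ) :
    Real.circleAverage (fun z => F z * z ^ (-l)) 0 r = laurentCoeff F l := by
  have hsub : Metric.closedBall (0 : ℂ) r ⊆ disc := Metric.closedBall_subset_ball h1
  have hd : DifferentiableOn ℂ F (Metric.closedBall 0 r) := hF.mono hsub
  obtain ⟨m, rfl | rfl⟩ := l.eq_nat_or_neg
  · rw [laurentCoeff_natCast, Real.circleAverage_eq_circleIntegral h0.ne']
    have h := hd.circleIntegral_one_div_sub_center_pow_smul h0 m
    have he : (fun z : ℂ => (z - 0)⁻¹ • (F z * z ^ (-(m : ℤ)))) =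
        fun z => (1 / (z - 0) ^ (m + 1)) • F z := by
      funext z
      simp only [sub_zero, smul_eq_mul, zpow_neg, zpow_natCast, pow_succ, one_div, mul_inv]
      ring
    rw [he, h, smul_smul, taylorCoeff, smul_eq_mul]
    have := Complex.two_pi_I_ne_zero
    field_simp
  · rcases Nat.eq_zero_or_pos m with rfl | hm
    · have h : DiffContOnCl ℂ F (Metric.ball 0 |r|) := by
        rw [abs_of_pos h0]
        exact (hd.mono Metric.closure_ball_subset_closedBall).diffContOnCl
      have := laurentCoeff_natCast F 0
      rw [Nat.cast_zero] at this
      simpa [this, taylorCoeff_zero] using h.circleAverage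
    · have h : DiffContOnCl ℂ (fun z => F z * z ^ m) (Metric.ball 0 |r|) := by
        rw [abs_of_pos h0]
        exact ((hd.mul (differentiable_pow m).differentiableOn).mono
          Metric.closure_ball_subset_closedBall).diffContOnCl
      rw [laurentCoeff_of_neg _ (by omega)]
      simpa [hm.ne'] using h.circleAverage

/-- The value at `w` of the Laurent polynomial with coefficients `c`. -/
noncomputable def laurentEval (w : ℂ) : (ℤ →₀ ℂ) →ₗ[ℂ] ℂ :=
  Finsupp.linearCombination ℂ fun l => w ^ l

/-- The pairing of a Laurent polynomial on the unit circle with the boundary distribution of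
`2 Re g`. -/
noncomputable def boundaryPairing (g : ℂ → ℂ) : (ℤ →₀ ℂ) →ₗ[ℂ] ℂ :=
  Finsupp.linearCombination ℂ fun l => laurentCoeff g (-l) + conj (laurentCoeff g l)

theorem laurentEval_single (w : ℂ) (l : ℤ) (a : ℂ) :
    laurentEval w (Finsupp.single l a) = a * w ^ l := by
  simp [laurentEval]

theorem boundaryPairing_single (g : ℂ → ℂ) (l : ℤ) (a : ℂ) :
    boundaryPairing g (Finsupp.single l a) =
      a * (laurentCoeff g (-l) + conj (laurentCoeff g l)) := by
  simp [boundaryPairing]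

theorem circleIntegrable_mul_zpow {F : ℂ → ℂ} {r : ℝ} (h0 : 0 < r)
    (hF : ContinuousOn F (Metric.sphere 0 r)) (l : ℤ) :
    CircleIntegrable (fun z => F z * z ^ l) 0 r := by
  refine ContinuousOn.circleIntegrable h0.le (hF.mul fun z hz => ?_)
  refine (continuousAt_zpow₀ z l (Or.inl ?_)).continuousWithinAt
  rintro rfl
  simp [h0.ne] at hz

theorem continuousOn_sphere {g : ℂ → ℂ} (hg : DifferentiableOn ℂ g disc) {r : ℝ} (h1 : r < 1) :
    ContinuousOn g (Metric.sphere 0 r) :=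
  hg.continuousOn.mono (Metric.sphere_subset_closedBall.trans (Metric.closedBall_subset_ball h1))

theorem circleAverage_conj {F : ℂ → ℂ} {r : ℝ} (hF : CircleIntegrable F 0 r) :
    Real.circleAverage (fun z => conj (F z)) 0 r = conj (Real.circleAverage F 0 r) :=
  (Complex.conjCLE : ℂ →L[ℝ] ℂ).circleAverage_comp_comm hF

theorem circleAverage_re {F : ℂ → ℂ} {r : ℝ} (hF : CircleIntegrable F 0 r) :
    Real.circleAverage (fun z => (F z).re) 0 r = (Real.circleAverage F 0 r).re :=
  Complex.reCLM.circleAverage_comp_comm hF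

/-- On |z| = r one has conj z = r²/z, so the conjugate half of 2 Re g is again an average of g
against a power of z. At r = 1 the right-hand side is the weight of index l in `boundaryPairing`. -/
theorem circleAverage_re_mul_zpow {g : ℂ → ℂ} (hg : DifferentiableOn ℂ g disc) {r : ℝ}
    (h0 : 0 < r) (h1 : r < 1) (l : ℤ) :
    Real.circleAverage (fun z => (g z + conj (g z)) * (z / r) ^ l) 0 r =
      (r : ℂ) ^ (-l) * laurentCoeff g (-l) + (r : ℂ) ^ l * conj (laurentCoeff g l) := by
  have hr : (r : ℂ) ≠ 0 := by exact_mod_cast h0.ne'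
  have hc := continuousOn_sphere hg h1
  have i1 := circleIntegrable_mul_zpow h0 hc l
  have i2 := circleIntegrable_mul_zpow h0 hc (-l)
  have e1 := circleAverage_mul_zpow hg h0 h1 (-l)
  have e2 := circleAverage_mul_zpow hg h0 h1 l
  rw [neg_neg] at e1
  have hcong : Set.EqOn (fun z : ℂ => (g z + conj (g z)) * (z / r) ^ l)
      (fun z => (r : ℂ) ^ (-l) • (g z * z ^ l) + (r : ℂ) ^ l • conj (g z * z ^ (-l)))
      (Metric.sphere 0 |r|) := by
    intro z hz
    have hz' : ‖z‖ = r := by simpa [abs_of_pos h0] using hz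
    have hz0 : z ≠ 0 := by rw [← norm_pos_iff, hz']; exact h0
    have hconj : conj z = (r : ℂ) ^ 2 / z := by
      rw [eq_div_iff hz0, mul_comm, Complex.mul_conj, Complex.normSq_eq_norm_sq, hz']
      push_cast; rfl
    have hpow : conj (z ^ (-l)) = z ^ l / ((r : ℂ) ^ l * (r : ℂ) ^ l) := by
      rw [map_zpow₀, hconj, zpow_neg, div_zpow, inv_div, pow_two, mul_zpow]
    beta_reduce
    rw [map_mul, hpow, div_zpow, zpow_neg, smul_eq_mul, smul_eq_mul]
    have := zpow_ne_zero l hr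
    have := zpow_ne_zero l hz0
    field_simp
  rw [Real.circleAverage_congr_sphere hcong, Real.circleAverage_fun_add,
    Real.circleAverage_fun_smul, Real.circleAverage_fun_smul, circleAverage_conj i2, e1, e2]
  · rfl
  · exact i1.const_smul
  · have : CircleIntegrable (fun z => conj (g z * z ^ (-l))) 0 r := by
      refine ContinuousOn.circleIntegrable h0.le (Complex.continuous_conj.comp_continuousOn
        (hc.mul fun z hz => (continuousAt_zpow₀ z (-l) (Or.inl ?_)).continuousWithinAt))
      rintro rfl
      simp [h0.ne] at hz
    exact this.const_smul

/-- For r < 1 the average of 2 Re g(z)·c(z/r) over |z| = r has nonpositive real part, because 2 Re g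
is real and nonpositive while Re c ≥ 0. It is a finite sum continuous in r that tends to the pairing
as r → 1. -/
theorem boundaryPairing_re_nonpos {g : ℂ → ℂ} (hg : DifferentiableOn ℂ g disc)
    (hre : ∀ z ∈ disc, (g z).re ≤ 0) {c : ℤ →₀ ℂ}
    (hc : ∀ w : ℂ, ‖w‖ = 1 → 0 ≤ (laurentEval w c).re) : (boundaryPairing g c).re ≤ 0 := by
  set A : ℝ → ℂ := fun r => c.sum fun l a => a * ((r : ℂ) ^ (-l) * laurentCoeff g (-l) +
    (r : ℂ) ^ l * conj (laurentCoeff g l)) with hA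
  have hlim : Tendsto A (𝓝[<] 1) (𝓝 (boundaryPairing g c)) := by
    have hAc : ContinuousAt A 1 := by
      simp only [hA, Finsupp.sum]
      refine tendsto_finsetSum _ fun l _ => ?_
      have hz : ∀ l : ℤ, ContinuousAt (fun r : ℝ => (r : ℂ) ^ l) 1 := fun l =>
        ContinuousAt.zpow₀ Complex.continuous_ofReal.continuousAt l (Or.inl (by simp))
      exact continuousAt_const.mul (((hz _).mul continuousAt_const).add
        ((hz _).mul continuousAt_const))
    have h1 : A 1 = boundaryPairing g c := by
      simp [hA, boundaryPairing, Finsupp.linearCombination_apply]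
    rw [← h1]
    exact hAc.mono_left nhdsWithin_le_nhds
  refine le_of_tendsto ((Complex.continuous_re.tendsto _).comp hlim) ?_
  filter_upwards [Ioo_mem_nhdsLT (zero_lt_one' ℝ)] with r hr
  obtain ⟨h0, h1⟩ := hr
  have hcs := continuousOn_sphere hg h1
  have hint : ∀ l : ℤ, CircleIntegrable (fun z => (g z + conj (g z)) * (z / r) ^ l) 0 r := by
    intro l
    have := (circleIntegrable_mul_zpow h0 (hcs.add (Complex.continuous_conj.comp_continuousOn hcs))
      l).const_smul (a := ((r : ℂ) ^ l)⁻¹)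
    refine this.congr ?_
    refine fun z _ => ?_
    simp only [Pi.smul_apply, Pi.add_apply, Function.comp_apply, smul_eq_mul, div_eq_mul_inv,
      mul_zpow, inv_zpow]
    ring
  have hsum : (fun z => (g z + conj (g z)) * laurentEval (z / r) c) =
      fun z => ∑ l ∈ c.support, c l • ((g z + conj (g z)) * (z / r) ^ l) := by
    funext z
    simp only [laurentEval, Finsupp.linearCombination_apply, Finsupp.sum, Finset.mul_sum,
      smul_eq_mul]
    exact Finset.sum_congr rfl fun l _ => by ring
  have hint' : ∀ l ∈ c.support,
      CircleIntegrable (fun z => c l • ((g z + conj (g z)) * (z / r) ^ l)) 0 r :=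
    fun l _ => (hint l).const_smul
  have hAr : A r =
      Real.circleAverage (fun z => (g z + conj (g z)) * laurentEval (z / r) c) 0 r := by
    rw [hsum, Real.circleAverage_fun_sum hint']
    simp only [hA, Finsupp.sum]
    refine Finset.sum_congr rfl fun l _ => ?_
    rw [Real.circleAverage_fun_smul, circleAverage_re_mul_zpow hg h0 h1, smul_eq_mul]
  have hi : CircleIntegrable (fun z => (g z + conj (g z)) * laurentEval (z / r) c) 0 r := by
    rw [hsum]
    exact CircleIntegrable.fun_sum _ hint'
  have hAre : (A r).re = Real.circleAverage
      (fun z => (((g z + conj (g z)) * laurentEval (z / r) c)).re) 0 r := by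
    rw [hAr, circleAverage_re hi]
  show (A r).re ≤ 0
  rw [hAre]
  have hneg := Real.circleAverage_nonneg_of_nonneg (c := 0) (R := r)
    (f := fun z => (-1 : ℝ) • (((g z + conj (g z)) * laurentEval (z / r) c)).re) ?_
  · rw [Real.circleAverage_fun_smul] at hneg
    simpa using hneg
  · intro z hz
    have hz' : ‖z‖ = r := by simpa [abs_of_pos h0] using hz
    have h2 := hre z (by simpa [disc, hz'] using h1)
    have h3 := hc (z / r) (by simp [hz', abs_of_pos h0, h0.ne'])
    rw [Complex.add_conj, Complex.re_ofReal_mul, smul_eq_mul]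
    nlinarith

/-! ### Laurent polynomials on the circle: shifts, derivative, Taylor estimate -/

/-- Multiplication of a Laurent polynomial by `T ^ k`. -/
noncomputable def laurentShift (k : ℤ) : (ℤ →₀ ℂ) →ₗ[ℂ] (ℤ →₀ ℂ) :=
  Finsupp.linearCombination ℂ fun l => Finsupp.single (l + k) 1

/-- The Euler operator `T d/dT` on Laurent polynomials. -/
noncomputable def laurentEuler : (ℤ →₀ ℂ) →ₗ[ℂ] (ℤ →₀ ℂ) :=
  Finsupp.linearCombination ℂ fun l => Finsupp.single l (l : ℂ)

theorem laurentShift_single (k l : ℤ) (a : ℂ) :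
    laurentShift k (Finsupp.single l a) = Finsupp.single (l + k) a := by
  simp [laurentShift]

theorem laurentEuler_single (l : ℤ) (a : ℂ) :
    laurentEuler (Finsupp.single l a) = Finsupp.single l (a * l) := by
  simp [laurentEuler]

theorem laurentEval_shift {w : ℂ} (hw : w ≠ 0) (k : ℤ) (c : ℤ →₀ ℂ) :
    laurentEval w (laurentShift k c) = w ^ k * laurentEval w c := by
  induction c using Finsupp.induction_linear with
  | zero => simp
  | add c d hc hd => simp only [map_add, hc, hd, mul_add]
  | single l a =>
    rw [laurentShift_single, laurentEval_single, laurentEval_single, zpow_add₀ hw]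
    ring

theorem laurentEval_eq_sum (w : ℂ) (c : ℤ →₀ ℂ) :
    laurentEval w c = ∑ l ∈ c.support, c l * w ^ l := by
  simp [laurentEval, Finsupp.linearCombination_apply, Finsupp.sum]

theorem laurentEval_euler (w : ℂ) (c : ℤ →₀ ℂ) :
    laurentEval w (laurentEuler c) = ∑ l ∈ c.support, c l * (l * w ^ l) := by
  rw [laurentEuler, Finsupp.linearCombination_apply, Finsupp.sum, map_sum]
  refine Finset.sum_congr rfl fun l _ => ?_
  rw [map_smul, laurentEval_single, smul_eq_mul]

theorem norm_le_of_forall_re_mul_le {x : ℂ} {B : ℝ}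
    (h : ∀ α : ℂ, ‖α‖ = 1 → (α * x).re ≤ B) : ‖x‖ ≤ B := by
  rcases eq_or_ne x 0 with rfl | hx
  · simpa using h 1 (by simp)
  · have hn : (‖x‖ : ℂ) ≠ 0 := by simpa using hx
    have h1 := h (conj x / ‖x‖) (by simp [hx])
    have h2 : conj x / ‖x‖ * x = (‖x‖ : ℂ) := by
      rw [div_mul_eq_mul_div, mul_comm, Complex.mul_conj, Complex.normSq_eq_norm_sq]
      push_cast
      field_simp
    rwa [h2, Complex.ofReal_re] at h1

/-- Second-order Taylor bound in the angle, term by term; I times the Euler operator is the angular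
derivative. The smallness of h puts each exponent in the range where |exp x - 1 - x| ≤ |x|². -/
theorem norm_laurentEval_rotate_sub_le (c : ℤ →₀ ℂ) {w : ℂ} (hw : ‖w‖ = 1) {h : ℝ}
    (hh : ∀ l ∈ c.support, |(l : ℝ)| * |h| ≤ 1) :
    ‖laurentEval (w * exp (I * h)) c - laurentEval w c - I * h * laurentEval w (laurentEuler c)‖ ≤
      (∑ l ∈ c.support, ‖c l‖ * (l : ℝ) ^ 2) * h ^ 2 := by
  rw [laurentEval_euler, laurentEval_eq_sum, laurentEval_eq_sum, Finset.mul_sum,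
    ← Finset.sum_sub_distrib, ← Finset.sum_sub_distrib, Finset.sum_mul]
  refine (norm_sum_le _ _).trans (Finset.sum_le_sum fun l hl => ?_)
  have he : c l * (w * exp (I * h)) ^ l - c l * w ^ l - I * h * (c l * (l * w ^ l)) =
      c l * w ^ l * (exp (l * (I * h)) - 1 - l * (I * h)) := by
    rw [mul_zpow, ← Complex.exp_int_mul]
    ring
  have hn : ‖(l : ℂ) * (I * h)‖ = |(l : ℝ)| * |h| := by
    simp [Complex.norm_intCast]
  have hb := Complex.norm_exp_sub_one_sub_id_le (x := l * (I * h)) (by rw [hn]; exact hh l hl)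
  rw [hn, mul_pow, sq_abs, sq_abs] at hb
  rw [he, norm_mul, norm_mul, norm_zpow, hw, one_zpow, mul_one, mul_assoc]
  exact mul_le_mul_of_nonneg_left hb (norm_nonneg _)

/-! ### Annihilation of the multiples of q and of its Euler derivative -/

section Vanishing

variable {g : ℂ → ℂ} {q : ℤ →₀ ℂ}

/-- For |α| = 1 the polynomial q + α w^k q still has nonnegative real part on the circle, so adding
α w^k q cannot make the pairing positive; α is arbitrary. -/
theorem boundaryPairing_shift_eq_zero (hg : DifferentiableOn ℂ g disc)
    (hre : ∀ z ∈ disc, (g z).re ≤ 0)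
    (hq : ∀ w : ℂ, ‖w‖ = 1 → 0 ≤ (laurentEval w q).re ∧ (laurentEval w q).im = 0)
    (hq0 : (boundaryPairing g q).re = 0) (k : ℤ) :
    boundaryPairing g (laurentShift k q) = 0 := by
  rw [← norm_le_zero_iff]
  refine norm_le_of_forall_re_mul_le fun α hα => ?_
  have h := boundaryPairing_re_nonpos hg hre (c := q + α • laurentShift k q) fun w hw => ?_
  · simpa [hq0] using h
  · have hw0 : w ≠ 0 := by rw [← norm_pos_iff, hw]; exact one_pos
    obtain ⟨h1, h2⟩ := hq w hw
    have h3 : ‖α * w ^ k‖ = 1 := by simp [hα, hw]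
    have h4 := (abs_le.1 (h3 ▸ Complex.abs_re_le_norm (α * w ^ k))).1
    rw [map_add, map_smul, laurentEval_shift hw0, smul_eq_mul, ← mul_assoc, Complex.add_re,
      Complex.mul_re (α * w ^ k), h2]
    nlinarith

/-- Quantitative form of the fact that a nonnegative function has zero derivative at its zeros:
compare q at w with q ≥ 0 at w·exp(±iε). -/
theorem exists_norm_laurentEval_euler_le
    (hq : ∀ w : ℂ, ‖w‖ = 1 → 0 ≤ (laurentEval w q).re ∧ (laurentEval w q).im = 0) :
    ∃ C : ℝ, ∃ δ > 0, 0 ≤ C ∧ ∀ ε : ℝ, 0 < ε → ε ≤ δ → ∀ w : ℂ, ‖w‖ = 1 →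
      ‖laurentEval w (laurentEuler q)‖ ≤ C * ε + ε⁻¹ * (laurentEval w q).re := by
  set S : ℝ := ∑ l ∈ q.support, |(l : ℝ)| with hS
  have hS0 : 0 ≤ S := Finset.sum_nonneg fun _ _ => abs_nonneg _
  set K : ℝ := ∑ l ∈ q.support, ‖q l‖ * (l : ℝ) ^ 2 with hK
  have hK0 : 0 ≤ K := Finset.sum_nonneg fun _ _ => by positivity
  -- One K bounds the real part, which is only Taylor error since q is real on the circle; the other
  -- comes from the imaginary part. The bound on ε ensures |l|ε ≤ 1 on the support.
  refine ⟨2 * K, (1 + S)⁻¹, by positivity, by positivity, fun ε hε hεδ w hw => ?_⟩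
  have hsm : ∀ h : ℝ, |h| = ε → ∀ l ∈ q.support, |(l : ℝ)| * |h| ≤ 1 := by
    intro h hh l hl
    have h1 : |(l : ℝ)| ≤ S :=
      Finset.single_le_sum (f := fun l : ℤ => |(l : ℝ)|) (fun _ _ => abs_nonneg _) hl
    rw [hh]
    calc |(l : ℝ)| * ε ≤ (1 + S) * (1 + S)⁻¹ := by gcongr; linarith
      _ = 1 := mul_inv_cancel₀ (by positivity)
  have key : ∀ h : ℝ, |h| = ε →
      |h * (laurentEval w (laurentEuler q)).re| ≤ K * ε ^ 2 ∧
      h * (laurentEval w (laurentEuler q)).im ≤ (laurentEval w q).re + K * ε ^ 2 := by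
    intro h hh
    have hb := norm_laurentEval_rotate_sub_le q hw (hsm h hh)
    rw [← sq_abs h, hh] at hb
    have hw' : ‖w * exp (I * h)‖ = 1 := by
      rw [norm_mul, hw, mul_comm I, Complex.norm_exp_ofReal_mul_I, one_mul]
    obtain ⟨p1, p2⟩ := hq _ hw'
    obtain ⟨p3, p4⟩ := hq w hw
    have hi := (Complex.abs_im_le_norm _).trans hb
    have hr := (Complex.abs_re_le_norm _).trans hb
    simp only [Complex.sub_im, Complex.sub_re, p2, p4, mul_assoc, Complex.I_mul_re,
      Complex.I_mul_im, Complex.re_ofReal_mul, Complex.im_ofReal_mul] at hi hr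
    refine ⟨by simpa using hi, ?_⟩
    have := (abs_le.1 hr).2
    linarith
  obtain ⟨a1, a2⟩ := key ε (abs_of_pos hε)
  obtain ⟨-, a4⟩ := key (-ε) (by rw [abs_neg, abs_of_pos hε])
  set e := laurentEval w (laurentEuler q)
  have hre : ε * |e.re| ≤ K * ε ^ 2 := by rwa [abs_mul, abs_of_pos hε] at a1
  have him : ε * |e.im| ≤ (laurentEval w q).re + K * ε ^ 2 := by
    rcases abs_cases e.im with ⟨h, _⟩ | ⟨h, _⟩ <;> rw [h] <;> linarith
  have hsum : ε * ‖e‖ ≤ ε * (2 * K * ε + ε⁻¹ * (laurentEval w q).re) := by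
    have h1 := mul_le_mul_of_nonneg_left (Complex.norm_le_abs_re_add_abs_im e) hε.le
    have h2 : ε * (2 * K * ε + ε⁻¹ * (laurentEval w q).re) =
        2 * (K * ε ^ 2) + (laurentEval w q).re := by field_simp
    rw [h2]
    linarith
  exact le_of_mul_le_mul_left hsum hε

theorem boundaryPairing_shift_euler_eq_zero (hg : DifferentiableOn ℂ g disc)
    (hre : ∀ z ∈ disc, (g z).re ≤ 0)
    (hq : ∀ w : ℂ, ‖w‖ = 1 → 0 ≤ (laurentEval w q).re ∧ (laurentEval w q).im = 0)
    (hq0 : (boundaryPairing g q).re = 0) (k : ℤ) :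
    boundaryPairing g (laurentShift k (laurentEuler q)) = 0 := by
  obtain ⟨C, δ, hδ, hC, hb⟩ := exists_norm_laurentEval_euler_le hq
  set x := boundaryPairing g (laurentShift k (laurentEuler q))
  set m := (boundaryPairing g (Finsupp.single 0 1)).re
  have hx : ∀ ε : ℝ, 0 < ε → ε ≤ δ → ‖x‖ ≤ C * ε * -m := by
    intro ε hε hεδ
    refine norm_le_of_forall_re_mul_le fun α hα => ?_
    -- The first two terms dominate the modulus of the third on the circle. The pairing kills q,
    -- leaving only the O(ε) constant term as a bound for x.
    have h := boundaryPairing_re_nonpos hg hre (c := ((C * ε : ℝ) : ℂ) • Finsupp.single 0 1 +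
      ((ε⁻¹ : ℝ) : ℂ) • q + α • laurentShift k (laurentEuler q)) fun w hw => ?_
    · rw [map_add, map_add, map_smul, map_smul, map_smul, Complex.add_re, Complex.add_re,
        smul_eq_mul, smul_eq_mul, smul_eq_mul, Complex.re_ofReal_mul, Complex.re_ofReal_mul,
        hq0] at h
      linarith
    · have hw0 : w ≠ 0 := by rw [← norm_pos_iff, hw]; exact one_pos
      have h1 := hb ε hε hεδ w hw
      have h2 : ‖α * (w ^ k * laurentEval w (laurentEuler q))‖ =
          ‖laurentEval w (laurentEuler q)‖ := by simp [hα, hw]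
      have h3 := (abs_le.1 (Complex.abs_re_le_norm
        (α * (w ^ k * laurentEval w (laurentEuler q))))).1
      rw [map_add, map_add, map_smul, map_smul, map_smul, Complex.add_re, Complex.add_re,
        smul_eq_mul, smul_eq_mul, smul_eq_mul, Complex.re_ofReal_mul, Complex.re_ofReal_mul,
        laurentEval_shift hw0, laurentEval_single, zpow_zero, mul_one, Complex.one_re]
      linarith
  have hlim : Tendsto (fun ε : ℝ => C * ε * -m) (𝓝[>] 0) (𝓝 0) := by
    have : Continuous fun ε : ℝ => C * ε * -m := by fun_prop
    simpa using (this.tendsto 0).mono_left nhdsWithin_le_nhds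
  rw [← norm_le_zero_iff]
  refine ge_of_tendsto hlim ?_
  filter_upwards [Ioc_mem_nhdsGT hδ] with ε hε using hx ε hε.1 hε.2

end Vanishing

/-! ### First variation at an extremal function -/

theorem norm_taylorCoeff_le {F : ℂ → ℂ} (hF : DifferentiableOn ℂ F disc) {B : ℝ}
    (hB : ∀ z ∈ Metric.sphere (0 : ℂ) (1 / 2), ‖F z‖ ≤ B) (n : ℕ) :
    ‖taylorCoeff n F‖ ≤ B * 2 ^ n := by
  have hd : DiffContOnCl ℂ F (Metric.ball 0 (1 / 2)) :=
    (hF.mono (Metric.closure_ball_subset_closedBall.trans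
      (Metric.closedBall_subset_ball (by norm_num)))).diffContOnCl
  have h := Complex.norm_iteratedDeriv_le_of_forall_mem_sphere_norm_le n (by norm_num) hd hB
  have hn : (0 : ℝ) < n.factorial := by exact_mod_cast n.factorial_pos
  rw [taylorCoeff, norm_div, Complex.norm_natCast, div_le_iff₀ hn]
  refine h.trans_eq ?_
  rw [one_div, inv_pow, div_inv_eq_mul]
  ring

section Variation

variable {n : ℕ} {f g : ℂ → ℂ}

theorem IsClassB0.re_nonpos (hf : IsClassB0 f) (hfg : ∀ z ∈ disc, f z = exp (g z)) :
    ∀ z ∈ disc, (g z).re ≤ 0 := by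
  intro z hz
  have h := (hf.2 z hz).2
  rwa [hfg z hz, Complex.norm_exp, Real.exp_le_one_iff] at h

/-- First variation: an admissible direction `h` for the logarithm of an extremal function does
not increase the functional to first order. -/
theorem IsExtremal.re_taylorCoeff_mul_nonpos (hf : IsExtremal n f)
    (hfg : ∀ z ∈ disc, f z = exp (g z)) {h : ℂ → ℂ} (hh : DifferentiableOn ℂ h disc)
    (hadm : ∀ ε : ℝ, 0 < ε → ε ≤ 1 → ∀ z ∈ disc, (g z).re + ε * (h z).re ≤ 0) :
    (taylorCoeff n fun z => f z * h z).re ≤ 0 := by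
  have hfd : DifferentiableOn ℂ f disc := hf.1.1
  have hsub : Metric.sphere (0 : ℂ) (1 / 2) ⊆ disc :=
    Metric.sphere_subset_closedBall.trans (Metric.closedBall_subset_ball (by norm_num))
  obtain ⟨B, hB⟩ := (isCompact_sphere (0 : ℂ) (1 / 2)).exists_bound_of_continuousOn
    (hh.continuousOn.mono hsub)
  have hB0 : 0 ≤ B := (norm_nonneg _).trans (hB (1 / 2 : ℂ) (by simp))
  have hbound : ∀ ε : ℝ, 0 < ε → ε ≤ (1 + B)⁻¹ →
      (taylorCoeff n fun z => f z * h z).re ≤ ε * (B ^ 2 * 2 ^ n) := by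
    intro ε hε hεB
    have hεB' : ε * B ≤ 1 := by
      calc ε * B ≤ (1 + B)⁻¹ * (1 + B) := by gcongr; linarith
        _ = 1 := inv_mul_cancel₀ (by positivity)
    have hε1 : ε ≤ 1 := hεB.trans (inv_le_one_of_one_le₀ (by linarith))
    have hed : DifferentiableOn ℂ (fun z => exp (ε * h z)) disc := (hh.const_mul _).cexp
    have hFcls : IsClassB0 fun z => f z * exp (ε * h z) := by
      refine ⟨hfd.mul hed, fun z hz => ⟨?_, ?_⟩⟩
      · rw [norm_mul, Complex.norm_exp]
        exact mul_pos (hf.1.2 z hz).1 (Real.exp_pos _)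
      · beta_reduce
        rw [hfg z hz, ← Complex.exp_add, Complex.norm_exp, Real.exp_le_one_iff, Complex.add_re,
          Complex.re_ofReal_mul]
        exact hadm ε hε hε1 z hz
    have hrd : DifferentiableOn ℂ (fun z => f z * (exp (ε * h z) - 1 - ε * h z)) disc :=
      hfd.mul ((hed.sub_const 1).sub (hh.const_mul _))
    -- The remainder of exp(εh) is quadratic in ε on |z| = 1/2, where h is bounded even if it is
    -- unbounded on the disc; Cauchy's estimate there suffices.
    have hr : ‖taylorCoeff n fun z => f z * (exp (ε * h z) - 1 - ε * h z)‖ ≤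
        (ε * B) ^ 2 * 2 ^ n := by
      refine norm_taylorCoeff_le hrd (fun z hz => ?_) n
      have h1 : ‖(ε : ℂ) * h z‖ ≤ ε * B := by
        rw [norm_mul, Complex.norm_real, Real.norm_of_nonneg hε.le]
        exact mul_le_mul_of_nonneg_left (hB z hz) hε.le
      have h2 := Complex.norm_exp_sub_one_sub_id_le (h1.trans hεB')
      rw [norm_mul]
      calc ‖f z‖ * ‖exp (ε * h z) - 1 - ε * h z‖ ≤ 1 * ‖(ε : ℂ) * h z‖ ^ 2 :=
            mul_le_mul (hf.1.2 z (hsub hz)).2 h2 (norm_nonneg _) zero_le_one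
        _ ≤ (ε * B) ^ 2 := by rw [one_mul]; gcongr
    have hsplit : taylorCoeff n (fun z => f z * exp (ε * h z)) =
        taylorCoeff n f + ε * (taylorCoeff n fun z => f z * h z) +
          taylorCoeff n fun z => f z * (exp (ε * h z) - 1 - ε * h z) := by
      have hfh : DifferentiableOn ℂ (fun z => f z * h z) disc := hfd.mul hh
      have hsd : DifferentiableOn ℂ (fun z => f z + ε * (f z * h z)) disc :=
        hfd.add (hfh.const_mul _)
      rw [← taylorCoeff_const_mul, ← taylorCoeff_add n (analyticAt_zero hfd)
        (analyticAt_zero (hfh.const_mul _)), ← taylorCoeff_add n (analyticAt_zero hsd)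
        (analyticAt_zero hrd)]
      congr 1
      funext z
      ring
    have hM := hf.2 _ hFcls
    rw [M, M, hsplit, Complex.add_re, Complex.add_re, Complex.re_ofReal_mul] at hM
    have h3 := (abs_le.1 ((Complex.abs_re_le_norm _).trans hr)).1
    refine le_of_mul_le_mul_left ?_ hε
    nlinarith
  have hlim : Tendsto (fun ε : ℝ => ε * (B ^ 2 * 2 ^ n)) (𝓝[>] 0) (𝓝 0) := by
    have : Continuous fun ε : ℝ => ε * (B ^ 2 * 2 ^ n) := by fun_prop
    simpa using (this.tendsto 0).mono_left nhdsWithin_le_nhds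
  refine ge_of_tendsto hlim ?_
  filter_upwards [Ioc_mem_nhdsGT (show (0 : ℝ) < (1 + B)⁻¹ by positivity)] with ε hε
  exact hbound ε hε.1 hε.2

theorem IsExtremal.re_taylorCoeff_mul_log (hf : IsExtremal n f)
    (hg : DifferentiableOn ℂ g disc) (hfg : ∀ z ∈ disc, f z = exp (g z)) :
    (taylorCoeff n fun z => f z * g z).re = 0 := by
  have hre := hf.1.re_nonpos hfg
  refine le_antisymm (hf.re_taylorCoeff_mul_nonpos hfg hg fun ε hε _ z hz => ?_) ?_
  · nlinarith [hre z hz]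
  -- The direction -g is admissible because (1 - ε) Re g ≤ 0 for ε ≤ 1.
  · have h := hf.re_taylorCoeff_mul_nonpos hfg (h := fun z => (-1) * g z) (hg.const_mul _)
      fun ε hε h1 z hz => ?_
    · have he : (fun z => f z * ((-1) * g z)) = fun z => (-1) * (f z * g z) := by
        funext z; ring
      rw [he, taylorCoeff_const_mul] at h
      simpa using h
    · simp only [neg_mul, one_mul, Complex.neg_re]
      nlinarith [hre z hz]

theorem IsExtremal.conj_taylorCoeff (hf : IsExtremal n f)
    (hfg : ∀ z ∈ disc, f z = exp (g z)) : conj (taylorCoeff n f) = taylorCoeff n f := by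
  have hre := hf.1.re_nonpos hfg
  have key : ∀ s : ℝ, -(s * (taylorCoeff n f).im) ≤ 0 := by
    intro s
    have h := hf.re_taylorCoeff_mul_nonpos hfg (h := fun _ => (s : ℂ) * I)
      (differentiableOn_const _) fun ε hε h1 z hz => by simpa using hre z hz
    have he : (fun z => f z * ((s : ℂ) * I)) = fun z => ((s : ℂ) * I) * f z := by
      funext z; ring
    rw [he, taylorCoeff_const_mul] at h
    simpa using h
  rw [Complex.conj_eq_iff_im]
  linarith [key 1, key (-1)]

end Variation

/-! ### Herglotz kernels and positivity of Re P on the circle -/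

/-- The Herglotz kernel with pole at `1 / ζ`. -/
noncomputable def herglotz (ζ z : ℂ) : ℂ := (1 + ζ * z) / (1 - ζ * z)

theorem norm_mul_lt_one {ζ z : ℂ} (hζ : ‖ζ‖ = 1) (hz : z ∈ disc) : ‖ζ * z‖ < 1 := by
  rw [norm_mul, hζ, one_mul]
  simpa [disc] using hz

theorem one_sub_mul_ne_zero {ζ z : ℂ} (hζ : ‖ζ‖ = 1) (hz : z ∈ disc) : 1 - ζ * z ≠ 0 := by
  intro h
  have := norm_mul_lt_one hζ hz
  rw [← sub_eq_zero.1 h, norm_one] at this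
  exact lt_irrefl _ this

theorem differentiableOn_herglotz {ζ : ℂ} (hζ : ‖ζ‖ = 1) :
    DifferentiableOn ℂ (herglotz ζ) disc := by
  refine DifferentiableOn.div (by fun_prop) (by fun_prop) fun z hz => one_sub_mul_ne_zero hζ hz

theorem herglotz_re_nonneg {ζ z : ℂ} (hζ : ‖ζ‖ = 1) (hz : z ∈ disc) :
    0 ≤ (herglotz ζ z).re := by
  have h := norm_mul_lt_one hζ hz
  have h2 : Complex.normSq (ζ * z) ≤ 1 := by
    rw [Complex.normSq_eq_norm_sq]
    exact pow_le_one₀ (norm_nonneg _) h.le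
  rw [herglotz, Complex.div_re, ← add_div]
  refine div_nonneg ?_ (Complex.normSq_nonneg _)
  rw [Complex.normSq_apply] at h2
  simp only [Complex.add_re, Complex.sub_re, Complex.add_im, Complex.sub_im, Complex.one_re,
    Complex.one_im]
  linarith

/-- The kernel H satisfies H = 1 + ζz(1 + H), which gives a recursion for its coefficients. -/
theorem taylorCoeff_succ_herglotz {ζ : ℂ} (hζ : ‖ζ‖ = 1) (k : ℕ) :
    taylorCoeff (k + 1) (herglotz ζ) = 2 * ζ ^ (k + 1) := by
  have ha := analyticAt_zero (differentiableOn_herglotz hζ)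
  have h1 : AnalyticAt ℂ (fun _ : ℂ => (1 : ℂ)) 0 := analyticAt_const
  have hc : ∀ j, taylorCoeff j (fun _ : ℂ => (1 : ℂ)) = if j = 0 then 1 else 0 := fun j => by
    simpa [coeff_one] using taylorCoeff_eval j (1 : ℂ[X])
  have hrec : ∀ k, taylorCoeff (k + 1) (herglotz ζ) =
      ζ * ((if k = 0 then 1 else 0) + taylorCoeff k (herglotz ζ)) := by
    intro k
    have heq : taylorCoeff (k + 1) (herglotz ζ) =
        taylorCoeff (k + 1) (fun z => 1 + ζ * (z * (1 + herglotz ζ z))) := by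
      rw [taylorCoeff, taylorCoeff]
      congr 1
      refine Filter.EventuallyEq.iteratedDeriv_eq _ ?_
      filter_upwards [isOpen_disc.mem_nhds zero_mem_disc] with z hz
      have := one_sub_mul_ne_zero hζ hz
      rw [herglotz]
      field_simp
      ring
    rw [heq, taylorCoeff_add _ h1 (by fun_prop), taylorCoeff_const_mul,
      taylorCoeff_succ_id_mul (F := fun z => 1 + herglotz ζ z) k (h1.add ha), taylorCoeff_add k h1 ha, hc, hc,
      if_neg k.succ_ne_zero, zero_add]
  induction k with
  | zero =>
    rw [hrec, taylorCoeff_zero, herglotz]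
    simp only [if_true, mul_zero, add_zero, sub_zero, div_one, zero_add, pow_one]
    ring
  | succ k ih =>
    rw [hrec, ih, if_neg k.succ_ne_zero, zero_add, pow_succ ζ (k + 1)]
    ring

theorem taylorCoeff_mul_herglotz {f : ℂ → ℂ} (hf : AnalyticAt ℂ f 0) {ζ : ℂ} (hζ : ‖ζ‖ = 1)
    (n : ℕ) : taylorCoeff n (fun z => f z * herglotz ζ z) = (polyP n f).eval ζ := by
  rw [taylorCoeff_mul n hf (analyticAt_zero (differentiableOn_herglotz hζ)), polyP,
    ← Finset.sum_range_reflect, Finset.sum_range_succ', ← Finset.Ico_add_one_right_eq_Icc,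
    Finset.sum_Ico_eq_sum_range, add_comm]
  simp only [eval_add, eval_mul, eval_C, eval_finsetSum, eval_pow, eval_X, eval_ofNat,
    Nat.add_sub_cancel, Nat.sub_zero, Nat.sub_self, taylorCoeff_zero, Finset.mul_sum]
  congr 1
  · simp [herglotz]
  · refine Finset.sum_congr rfl fun j hj => ?_
    have hj' : j < n := Finset.mem_range.1 hj
    rw [show n - (n - (j + 1)) = j + 1 by omega, taylorCoeff_succ_herglotz hζ, add_comm 1 j]
    ring

theorem IsExtremal.polyP_eval_re_nonneg {n : ℕ} {f g : ℂ → ℂ} (hf : IsExtremal n f)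
    (hfg : ∀ z ∈ disc, f z = exp (g z)) {ζ : ℂ} (hζ : ‖ζ‖ = 1) :
    0 ≤ ((polyP n f).eval ζ).re := by
  have hre := hf.1.re_nonpos hfg
  have hd := differentiableOn_herglotz hζ
  have h := hf.re_taylorCoeff_mul_nonpos hfg (h := fun z => (-1) * herglotz ζ z) (hd.const_mul _)
    fun ε hε h1 z hz => ?_
  · have he : (fun z => f z * ((-1) * herglotz ζ z)) = fun z => (-1) * (f z * herglotz ζ z) := by
      funext z; ring
    rw [he, taylorCoeff_const_mul, taylorCoeff_mul_herglotz (analyticAt_zero hf.1.1) hζ] at h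
    simpa using h
  · have := herglotz_re_nonneg hζ hz
    simp only [neg_mul, one_mul, Complex.neg_re]
    nlinarith [hre z hz]

/-! ### Coefficients of the denominator and the numerators -/

theorem conj_two : conj (2 : ℂ) = 2 := map_ofNat _ 2

theorem coeff_polyP (n : ℕ) (F : ℂ → ℂ) (j : ℕ) :
    (polyP n F).coeff j =
      if j = 0 then taylorCoeff n F else if j ≤ n then 2 * taylorCoeff (n - j) F else 0 := by
  have h2 : (2 : ℂ[X]) = C 2 := rfl
  rw [polyP, h2, coeff_add, coeff_C, coeff_C_mul, finsetSum_coeff]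
  simp only [coeff_C_mul_X_pow, Finset.sum_ite_eq, Finset.mem_Icc]
  split_ifs <;> first | omega | simp

/-- The polynomial with conjugated coefficients. -/
noncomputable def conjPoly (p : ℂ[X]) : ℂ[X] := p.map (starRingEnd ℂ)

theorem eval_conjPoly (p : ℂ[X]) (z : ℂ) : (conjPoly p).eval z = conjEval p z := by
  rw [conjPoly, conjEval, eval_map]
  conv_lhs => rw [← Complex.conj_conj z]
  exact eval₂_at_apply (starRingEnd ℂ) (conj z)

theorem coeff_conjPoly (p : ℂ[X]) (k : ℕ) : (conjPoly p).coeff k = conj (p.coeff k) :=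
  coeff_map _ _

/-- The common denominator as a polynomial. -/
noncomputable def denPoly (n : ℕ) (f : ℂ → ℂ) : ℂ[X] :=
  (polyP n f).reflect n + X ^ n * conjPoly (polyP n f)

/-- The numerator of the formula for `g` as a polynomial. -/
noncomputable def numGPoly (n : ℕ) (f g : ℂ → ℂ) : ℂ[X] :=
  (polyQ n f g).reflect n - X ^ n * conjPoly (polyQ n f g)

/-- The numerator of the formula for `z g'` as a polynomial. -/
noncomputable def numDGPoly (n : ℕ) (f : ℂ → ℂ) : ℂ[X] :=
  (derivative (polyP n f)).reflect (n - 1) + X ^ (n + 1) * conjPoly (derivative (polyP n f))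

theorem eval_denPoly (n : ℕ) (f : ℂ → ℂ) (z : ℂ) : (denPoly n f).eval z = den n f z := by
  rw [denPoly, eval_add, eval_mul, eval_conjPoly, eval_pow, eval_X]
  rfl

theorem eval_numGPoly (n : ℕ) (f g : ℂ → ℂ) (z : ℂ) :
    (numGPoly n f g).eval z = numG n f g z := by
  rw [numGPoly, eval_sub, eval_mul, eval_conjPoly, eval_pow, eval_X]
  rfl

theorem eval_numDGPoly (n : ℕ) (f : ℂ → ℂ) (z : ℂ) :
    (numDGPoly n f).eval z = numDG n f z := by
  rw [numDGPoly, eval_add, eval_mul, eval_conjPoly, eval_pow, eval_X]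
  rfl

theorem coeff_reflect_polyP (n : ℕ) (F : ℂ → ℂ) (k : ℕ) :
    ((polyP n F).reflect n).coeff k =
      if k < n then 2 * taylorCoeff k F else if k = n then taylorCoeff n F else 0 := by
  rw [coeff_reflect]
  rcases le_or_gt k n with hk | hk
  · rw [revAt_le hk, coeff_polyP]
    split_ifs with h1 h2 h3 <;> first | omega | rfl | skip
    rw [Nat.sub_sub_self hk]
  · rw [revAt_eq_self_of_lt hk, coeff_polyP]
    split_ifs <;> first | omega | rfl

theorem coeff_X_pow_mul_conjPoly_polyP (n : ℕ) (F : ℂ → ℂ) (k : ℕ) :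
    (X ^ n * conjPoly (polyP n F)).coeff k =
      if k < n then 0 else if k = n then conj (taylorCoeff n F) else
        if k ≤ 2 * n then 2 * conj (taylorCoeff (2 * n - k) F) else 0 := by
  rw [coeff_X_pow_mul', coeff_conjPoly, coeff_polyP]
  split_ifs <;> first | omega | rfl | skip
  · rw [map_mul, show n - (k - n) = 2 * n - k by omega, conj_two]
  · simp

/-- The two summands overlap only at index n, contributing a_n + conj a_n; reality of a_n makes this
2a_n, so the coefficients up to n are exactly those of 2f. -/
theorem coeff_denPoly {n : ℕ} {f : ℂ → ℂ} (hf : conj (taylorCoeff n f) = taylorCoeff n f)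
    (k : ℕ) : (denPoly n f).coeff k =
      if k ≤ n then 2 * taylorCoeff k f else
        if k ≤ 2 * n then 2 * conj (taylorCoeff (2 * n - k) f) else 0 := by
  rw [denPoly, coeff_add, coeff_reflect_polyP, coeff_X_pow_mul_conjPoly_polyP]
  rcases lt_trichotomy k n with hk | rfl | hk
  · simp [hk, hk.le]
  · simp [hf, two_mul]
  · simp [hk.not_gt, hk.not_ge, hk.ne']

/-- At the overlap index n the contribution T_n(fg) - conj T_n(fg) equals 2T_n(fg) because this
coefficient is purely imaginary. -/
theorem coeff_numGPoly {n : ℕ} {f g : ℂ → ℂ}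
    (hfg : (taylorCoeff n fun z => f z * g z).re = 0) (k : ℕ) :
    (numGPoly n f g).coeff k =
      if k ≤ n then 2 * taylorCoeff k (fun z => f z * g z) else
        if k ≤ 2 * n then -(2 * conj (taylorCoeff (2 * n - k) fun z => f z * g z)) else 0 := by
  rw [numGPoly, polyQ_eq, coeff_sub, coeff_reflect_polyP, coeff_X_pow_mul_conjPoly_polyP]
  have hc : conj (taylorCoeff n fun z => f z * g z) = -taylorCoeff n fun z => f z * g z := by
    apply Complex.ext <;> simp [hfg]
  rcases lt_trichotomy k n with hk | rfl | hk
  · simp [hk, hk.le]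
  · simp [hc, two_mul]
  · simp only [hk.not_gt, hk.not_ge, hk.ne', if_false]
    split_ifs <;> simp

theorem coeff_numDGPoly {n : ℕ} (hn : 1 ≤ n) (f : ℂ → ℂ) (k : ℕ) :
    (numDGPoly n f).coeff k =
      if k ≤ n then 2 * (n - k) * taylorCoeff k f else
        if k ≤ 2 * n then 2 * (k - n) * conj (taylorCoeff (2 * n - k) f) else 0 := by
  rw [numDGPoly, coeff_add, coeff_reflect, coeff_X_pow_mul', coeff_conjPoly, coeff_derivative,
    coeff_derivative, coeff_polyP, coeff_polyP, if_neg (Nat.succ_ne_zero _),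
    if_neg (Nat.succ_ne_zero _)]
  rcases lt_trichotomy k n with hk | rfl | hk
  · rw [revAt_le (show k ≤ n - 1 by omega), if_pos (by omega), if_neg (by omega),
      if_pos hk.le, add_zero, show n - (n - 1 - k + 1) = k by omega]
    have : ((n - 1 - k : ℕ) : ℂ) + 1 = n - k := by
      rw [← Nat.cast_sub hk.le, show n - k = n - 1 - k + 1 by omega]
      push_cast; rfl
    rw [this]
    ring
  · rw [revAt_eq_self_of_lt (by omega), if_neg (by omega), if_neg (by omega), if_pos le_rfl]
    simp
  · rw [revAt_eq_self_of_lt (by omega), if_neg (show ¬k + 1 ≤ n by omega),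
      if_pos (show n + 1 ≤ k from hk), if_neg hk.not_ge, zero_mul, zero_add]
    have : ((k - (n + 1) : ℕ) : ℂ) + 1 = k - n := by
      rw [← Nat.cast_sub hk.le, show k - n = k - (n + 1) + 1 by omega]
      push_cast; rfl
    rw [this]
    by_cases h : k ≤ 2 * n
    · rw [if_pos (show k - (n + 1) + 1 ≤ n by omega), if_pos h,
        show n - (k - (n + 1) + 1) = 2 * n - k by omega]
      simp only [map_mul, map_sub, map_natCast, conj_two]
      ring
    · rw [if_neg (show ¬k - (n + 1) + 1 ≤ n by omega), if_neg h, zero_mul, map_zero]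

/-! ### Coefficients of den·F and the pairing relations -/

/-- The convolution of the coefficients of the denominator with the Taylor coefficients
of `F`. -/
noncomputable def denConv (n : ℕ) (f F : ℂ → ℂ) (K : ℤ) : ℂ :=
  ∑ j ∈ Finset.range (2 * n + 1), (denPoly n f).coeff j * laurentCoeff F (K - j)

theorem denConv_of_neg (n : ℕ) (f F : ℂ → ℂ) {K : ℤ} (hK : K < 0) : denConv n f F K = 0 :=
  Finset.sum_eq_zero fun j _ => by rw [laurentCoeff_of_neg _ (by omega), mul_zero]

section Convolution

variable {n : ℕ} {f : ℂ → ℂ}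

theorem coeff_denPoly_eq_zero (hf : conj (taylorCoeff n f) = taylorCoeff n f) {j : ℕ}
    (hj : 2 * n < j) : (denPoly n f).coeff j = 0 := by
  rw [coeff_denPoly hf, if_neg (by omega), if_neg (by omega)]

theorem conj_coeff_denPoly (hf : conj (taylorCoeff n f) = taylorCoeff n f) {j : ℕ}
    (hj : j ≤ 2 * n) : conj ((denPoly n f).coeff (2 * n - j)) = (denPoly n f).coeff j := by
  rw [coeff_denPoly hf, coeff_denPoly hf, if_pos hj, if_pos (Nat.sub_le _ _),
    Nat.sub_sub_self hj]
  rcases lt_trichotomy j n with h | rfl | h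
  · rw [if_neg (by omega), if_pos h.le]
    simp [conj_two]
  · rw [show 2 * j - j = j by omega, if_pos le_rfl, map_mul, hf, conj_two]
  · rw [if_pos (by omega), if_neg (by omega)]
    simp [conj_two]

/-- The denominator is self-inversive: conjugation combined with j ↦ 2n - j preserves its
coefficients. -/
theorem sum_coeff_denPoly_mul_conj (hf : conj (taylorCoeff n f) = taylorCoeff n f) (F : ℂ → ℂ)
    (K : ℤ) : ∑ j ∈ Finset.range (2 * n + 1), (denPoly n f).coeff j *
      conj (laurentCoeff F (j - K)) = conj (denConv n f F (2 * n - K)) := by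
  rw [denConv, map_sum, ← Finset.sum_range_reflect]
  refine Finset.sum_congr rfl fun j hj => ?_
  have hj' : j ≤ 2 * n := by simpa [Nat.lt_succ_iff] using hj
  rw [Nat.add_sub_cancel, map_mul, ← conj_coeff_denPoly hf (Nat.sub_le (2 * n) j),
    Nat.sub_sub_self hj', show ((2 * n - j : ℕ) : ℤ) - K = 2 * n - K - j by omega]

theorem denConv_natCast (hf : conj (taylorCoeff n f) = taylorCoeff n f) (F : ℂ → ℂ) (k : ℕ) :
    denConv n f F k =
      ∑ i ∈ Finset.range (k + 1), (denPoly n f).coeff i * taylorCoeff (k - i) F := by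
  have h1 : denConv n f F k = ∑ i ∈ Finset.range (2 * n + 1 + (k + 1)),
      (denPoly n f).coeff i * laurentCoeff F (k - i) := by
    refine Finset.sum_subset (Finset.range_mono (by omega)) fun j _ hj => ?_
    rw [coeff_denPoly_eq_zero hf (by simpa using hj), zero_mul]
  have h2 : ∑ i ∈ Finset.range (k + 1), (denPoly n f).coeff i * laurentCoeff F (k - i) =
      ∑ i ∈ Finset.range (2 * n + 1 + (k + 1)),
      (denPoly n f).coeff i * laurentCoeff F (k - i) := by
    refine Finset.sum_subset (Finset.range_mono (by omega)) fun j _ hj => ?_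
    rw [Finset.mem_range] at hj
    rw [laurentCoeff_of_neg _ (by omega), mul_zero]
  rw [h1, ← h2]
  refine Finset.sum_congr rfl fun i hi => ?_
  rw [Finset.mem_range] at hi
  rw [← Nat.cast_sub (by omega), laurentCoeff_natCast]

theorem taylorCoeff_den_mul (hf : conj (taylorCoeff n f) = taylorCoeff n f) {F : ℂ → ℂ}
    (hF : AnalyticAt ℂ F 0) (k : ℕ) :
    taylorCoeff k (fun z => (denPoly n f).eval z * F z) = denConv n f F k := by
  rw [taylorCoeff_mul k ((differentiable_eval _).analyticAt 0) hF, denConv_natCast hf]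
  simp only [taylorCoeff_eval]

theorem denConv_of_le (hf : conj (taylorCoeff n f) = taylorCoeff n f) (ha : AnalyticAt ℂ f 0)
    {F : ℂ → ℂ} (hF : AnalyticAt ℂ F 0) {k : ℕ} (hk : k ≤ n) :
    denConv n f F k = 2 * taylorCoeff k (fun z => f z * F z) := by
  rw [denConv_natCast hf, taylorCoeff_mul k ha hF, Finset.mul_sum]
  refine Finset.sum_congr rfl fun i hi => ?_
  rw [Finset.mem_range] at hi
  rw [coeff_denPoly hf, if_pos (by omega), mul_assoc]

/-- The denominator as a Laurent polynomial, divided by `T ^ n`: on the unit circle its value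
at `w` is `2 Re P(conj w)`. -/
noncomputable def denLaurent (n : ℕ) (f : ℂ → ℂ) : ℤ →₀ ℂ :=
  ∑ j ∈ Finset.range (2 * n + 1),
    Finsupp.single ((j : ℤ) - n) ((denPoly n f).coeff j)

theorem laurentEval_denLaurent (hf : conj (taylorCoeff n f) = taylorCoeff n f) {w : ℂ}
    (hw : ‖w‖ = 1) :
    laurentEval w (denLaurent n f) = ((2 * ((polyP n f).eval (conj w)).re : ℝ) : ℂ) := by
  have hw0 : w ≠ 0 := by rw [← norm_pos_iff, hw]; exact one_pos
  have hinv : 1 / w = conj w := by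
    rw [eq_comm, eq_div_iff hw0, mul_comm, Complex.mul_conj, Complex.normSq_eq_norm_sq, hw]
    simp
  have hdeg : (denPoly n f).natDegree < 2 * n + 1 :=
    Nat.lt_succ_of_le (natDegree_le_iff_coeff_eq_zero.2 fun j hj => coeff_denPoly_eq_zero hf hj)
  have h1 : w ^ n * laurentEval w (denLaurent n f) = den n f w := by
    rw [← eval_denPoly, eval_eq_sum_range' hdeg, denLaurent, map_sum, Finset.mul_sum]
    refine Finset.sum_congr rfl fun j _ => ?_
    rw [laurentEval_single, zpow_sub₀ hw0, zpow_natCast, zpow_natCast]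
    have := pow_ne_zero n hw0
    field_simp
  rw [den_eq n f w hw0, hinv, ← mul_add, Complex.add_conj] at h1
  exact mul_left_cancel₀ (pow_ne_zero n hw0) h1

theorem boundaryPairing_shift_denLaurent (hf : conj (taylorCoeff n f) = taylorCoeff n f)
    (g : ℂ → ℂ) (K : ℤ) :
    boundaryPairing g (laurentShift (n - K) (denLaurent n f)) =
      denConv n f g K + conj (denConv n f g (2 * n - K)) := by
  rw [← sum_coeff_denPoly_mul_conj hf, denConv, ← Finset.sum_add_distrib, denLaurent, map_sum,
    map_sum]
  refine Finset.sum_congr rfl fun j _ => ?_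
  rw [laurentShift_single, boundaryPairing_single, mul_add,
    show -((j : ℤ) - n + (n - K)) = K - j by ring, show (j : ℤ) - n + (n - K) = j - K by ring]

theorem laurentCoeff_id_mul_deriv {g : ℂ → ℂ} (hg : AnalyticAt ℂ g 0) (l : ℤ) :
    laurentCoeff (fun z => z * deriv g z) l = l * laurentCoeff g l := by
  rcases lt_or_ge l 0 with h | h
  · rw [laurentCoeff_of_neg _ h, laurentCoeff_of_neg _ h, mul_zero]
  · lift l to ℕ using h
    rw [laurentCoeff_natCast, laurentCoeff_natCast, taylorCoeff_id_mul_deriv _ hg]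
    rfl

/-- The j-th terms carry the factor (K - n) - (j - n) = K - j, exactly the index by which z d/dz
multiplies the coefficients of g. The conjugated term has index j - K, hence the minus sign. -/
theorem boundaryPairing_shift_euler_denLaurent (hf : conj (taylorCoeff n f) = taylorCoeff n f)
    {g : ℂ → ℂ} (hg : AnalyticAt ℂ g 0) (K : ℤ) :
    (K - n) * boundaryPairing g (laurentShift (n - K) (denLaurent n f)) -
      boundaryPairing g (laurentShift (n - K) (laurentEuler (denLaurent n f))) =
      denConv n f (fun z => z * deriv g z) K -
        conj (denConv n f (fun z => z * deriv g z) (2 * n - K)) := by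
  rw [← sum_coeff_denPoly_mul_conj hf, denConv, ← Finset.sum_sub_distrib, denLaurent, map_sum,
    map_sum, map_sum, map_sum, map_sum, Finset.mul_sum, ← Finset.sum_sub_distrib]
  refine Finset.sum_congr rfl fun j _ => ?_
  rw [laurentEuler_single, laurentShift_single, laurentShift_single,
    boundaryPairing_single, boundaryPairing_single, laurentCoeff_id_mul_deriv hg,
    laurentCoeff_id_mul_deriv hg,
    show -((j : ℤ) - n + (n - K)) = K - j by ring, show (j : ℤ) - n + (n - K) = j - K by ring]
  rw [map_mul, map_intCast]
  push_cast
  ring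

end Convolution

/-! ### The two formulas -/

section Formulas

variable {n : ℕ} {f g : ℂ → ℂ}

theorem IsExtremal.denLaurent_nonneg (hf : IsExtremal n f) (hfg : ∀ z ∈ disc, f z = exp (g z))
    (w : ℂ) (hw : ‖w‖ = 1) :
    0 ≤ (laurentEval w (denLaurent n f)).re ∧ (laurentEval w (denLaurent n f)).im = 0 := by
  rw [laurentEval_denLaurent (hf.conj_taylorCoeff hfg) hw, Complex.ofReal_re, Complex.ofReal_im]
  have h := hf.polyP_eval_re_nonneg hfg (ζ := conj w) (by simpa using hw)
  exact ⟨by positivity, rfl⟩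

theorem IsExtremal.boundaryPairing_denLaurent_re (hf : IsExtremal n f)
    (hg : DifferentiableOn ℂ g disc) (hfg : ∀ z ∈ disc, f z = exp (g z)) :
    (boundaryPairing g (denLaurent n f)).re = 0 := by
  have hreal := hf.conj_taylorCoeff hfg
  have h := boundaryPairing_shift_denLaurent hreal g n
  have hs : laurentShift ((n : ℤ) - n) (denLaurent n f) = denLaurent n f := by
    rw [sub_self, denLaurent, map_sum]
    exact Finset.sum_congr rfl fun j _ => by rw [laurentShift_single, add_zero]
  rw [hs, show 2 * (n : ℤ) - n = n by ring,
    denConv_of_le hreal (analyticAt_zero hf.1.1) (analyticAt_zero hg) le_rfl] at h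
  rw [h]
  simp [hf.re_taylorCoeff_mul_log hg hfg]

theorem IsExtremal.denConv_log (hf : IsExtremal n f)
    (hg : DifferentiableOn ℂ g disc) (hfg : ∀ z ∈ disc, f z = exp (g z)) (K : ℤ) :
    denConv n f g K = -conj (denConv n f g (2 * n - K)) := by
  have h := boundaryPairing_shift_denLaurent (hf.conj_taylorCoeff hfg) g K
  rw [boundaryPairing_shift_eq_zero hg (hf.1.re_nonpos hfg) (hf.denLaurent_nonneg hfg)
    (hf.boundaryPairing_denLaurent_re hg hfg)] at h
  exact eq_neg_of_add_eq_zero_left h.symm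

theorem IsExtremal.denConv_id_mul_deriv_log (hf : IsExtremal n f)
    (hg : DifferentiableOn ℂ g disc) (hfg : ∀ z ∈ disc, f z = exp (g z)) (K : ℤ) :
    denConv n f (fun z => z * deriv g z) K =
      conj (denConv n f (fun z => z * deriv g z) (2 * n - K)) := by
  have h := boundaryPairing_shift_euler_denLaurent (hf.conj_taylorCoeff hfg)
    (analyticAt_zero hg) K
  rw [boundaryPairing_shift_eq_zero hg (hf.1.re_nonpos hfg) (hf.denLaurent_nonneg hfg)
    (hf.boundaryPairing_denLaurent_re hg hfg),
    boundaryPairing_shift_euler_eq_zero hg (hf.1.re_nonpos hfg) (hf.denLaurent_nonneg hfg)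
    (hf.boundaryPairing_denLaurent_re hg hfg), mul_zero, sub_zero] at h
  exact sub_eq_zero.1 h.symm

theorem IsExtremal.den_mul_log (hf : IsExtremal n f)
    (hg : DifferentiableOn ℂ g disc) (hfg : ∀ z ∈ disc, f z = exp (g z)) :
    ∀ z ∈ disc, den n f z * g z = numG n f g z := by
  have hreal := hf.conj_taylorCoeff hfg
  have hfa := analyticAt_zero hf.1.1
  have hga := analyticAt_zero hg
  simp only [← eval_denPoly, ← eval_numGPoly]
  refine eqOn_of_taylorCoeff_eq ((differentiable_eval _).differentiableOn.mul hg)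
    (differentiable_eval _).differentiableOn fun k => ?_
  rw [taylorCoeff_den_mul hreal hga, taylorCoeff_eval,
    coeff_numGPoly (hf.re_taylorCoeff_mul_log hg hfg)]
  split_ifs with h1 h2
  · exact denConv_of_le hreal hfa hga h1
  · rw [hf.denConv_log hg hfg, show 2 * (n : ℤ) - k = ((2 * n - k : ℕ) : ℤ) by omega,
      denConv_of_le hreal hfa hga (by omega), map_mul, conj_two]
  · rw [hf.denConv_log hg hfg, denConv_of_neg _ _ _ (by omega), map_zero, neg_zero]

theorem IsExtremal.den_mul_id_mul_deriv_log (hn : 1 ≤ n) (hf : IsExtremal n f)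
    (hg : DifferentiableOn ℂ g disc) (hfg : ∀ z ∈ disc, f z = exp (g z)) :
    ∀ z ∈ disc, den n f z * (z * deriv g z) = n * den n f z - numDG n f z := by
  have hreal := hf.conj_taylorCoeff hfg
  have hfa := analyticAt_zero hf.1.1
  have hga := analyticAt_zero hg
  have hHd : DifferentiableOn ℂ (fun z => z * deriv g z) disc :=
    differentiableOn_id.mul (hg.deriv isOpen_disc)
  have hHa := analyticAt_zero hHd
  -- Up to index n the denominator acts as 2f, and f·zg' = zf' has coefficients k·a_k.
  have hlow : ∀ k ≤ n, denConv n f (fun z => z * deriv g z) k = 2 * (k * taylorCoeff k f) := by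
    intro k hk
    rw [denConv_of_le hreal hfa hHa hk, ← taylorCoeff_id_mul_deriv k hfa, taylorCoeff,
      taylorCoeff]
    congr 2
    refine Filter.EventuallyEq.iteratedDeriv_eq _ ?_
    filter_upwards [isOpen_disc.mem_nhds zero_mem_disc] with z hz
    have hd : HasDerivAt g (deriv g z) z :=
      (hg.differentiableAt (isOpen_disc.mem_nhds hz)).hasDerivAt
    have he : f =ᶠ[𝓝 z] fun z => exp (g z) :=
      Filter.eventuallyEq_of_mem (isOpen_disc.mem_nhds hz) hfg
    rw [he.deriv_eq, hd.cexp.deriv, hfg z hz]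
    ring
  have hpoly : ∀ z, n * den n f z - numDG n f z =
      (C (n : ℂ) * denPoly n f - numDGPoly n f).eval z := fun z => by
    rw [eval_sub, eval_mul, eval_C, eval_denPoly, eval_numDGPoly]
  simp only [hpoly]
  simp only [← eval_denPoly]
  refine eqOn_of_taylorCoeff_eq ((differentiable_eval _).differentiableOn.mul hHd)
    (differentiable_eval _).differentiableOn fun k => ?_
  rw [taylorCoeff_den_mul hreal hHa, taylorCoeff_eval, coeff_sub, coeff_C_mul,
    coeff_denPoly hreal, coeff_numDGPoly hn]
  split_ifs with h1 h2
  · rw [hlow k h1]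
    ring
  · rw [hf.denConv_id_mul_deriv_log hg hfg,
      show 2 * (n : ℤ) - k = ((2 * n - k : ℕ) : ℤ) by omega, hlow _ (by omega), map_mul, map_mul,
      conj_two, map_natCast, Nat.cast_sub h2]
    push_cast
    ring
  · rw [hf.denConv_id_mul_deriv_log hg hfg, denConv_of_neg _ _ _ (by omega)]
    simp

theorem den_zero_ne_zero (hn : 1 ≤ n) (h0 : f 0 ≠ 0) : den n f 0 ≠ 0 := by
  rw [← eval_denPoly, ← coeff_zero_eq_eval_zero, denPoly, coeff_add, coeff_reflect_polyP,
    coeff_X_pow_mul_conjPoly_polyP, if_pos (show 0 < n from hn), if_pos (show 0 < n from hn),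
    taylorCoeff_zero, add_zero]
  exact mul_ne_zero two_ne_zero h0

theorem finite_den_zeros (h : den n f 0 ≠ 0) : {z : ℂ | den n f z = 0}.Finite := by
  have hp : denPoly n f ≠ 0 := by
    intro hp
    rw [← eval_denPoly, hp, eval_zero] at h
    exact h rfl
  refine (Polynomial.finite_setOfPred_isRoot hp).subset fun z hz => ?_
  rw [Set.mem_ofPred_eq, IsRoot.def, eval_denPoly]
  exact hz

end Formulas

end Krzyz

theorem theorem2 (n : ℕ) (hn : 1 ≤ n) (f g : ℂ → ℂ)
    (hf : Krzyz.IsExtremal n f)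
    (hg : DifferentiableOn ℂ g Krzyz.disc)
    (hfg : ∀ z ∈ Krzyz.disc, f z = Complex.exp (g z)) :
    -- the denominator is not identically zero
    Krzyz.den n f 0 ≠ 0 ∧ {z : ℂ | Krzyz.den n f z = 0}.Finite ∧
    -- the two formulas, pointwise wherever the denominator does not vanish
    (∀ z ∈ Krzyz.disc, Krzyz.den n f z ≠ 0 →
      g z = Krzyz.numG n f g z / Krzyz.den n f z ∧
      z * deriv g z = n - Krzyz.numDG n f z / Krzyz.den n f z) ∧
    -- every other point of the disc is a removable singularity, with the right value
    (∀ z ∈ Krzyz.disc,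
      Tendsto (fun w => Krzyz.numG n f g w / Krzyz.den n f w) (𝓝[≠] z) (𝓝 (g z)) ∧
      Tendsto (fun w => n - Krzyz.numDG n f w / Krzyz.den n f w) (𝓝[≠] z)
        (𝓝 (z * deriv g z))) := by
  have h0 : Krzyz.den n f 0 ≠ 0 :=
    Krzyz.den_zero_ne_zero hn (norm_pos_iff.1 (hf.1.2 0 Krzyz.zero_mem_disc).1)
  have hfin := Krzyz.finite_den_zeros h0
  have hform : ∀ z ∈ Krzyz.disc, Krzyz.den n f z ≠ 0 →
      g z = Krzyz.numG n f g z / Krzyz.den n f z ∧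
      z * deriv g z = n - Krzyz.numDG n f z / Krzyz.den n f z := by
    intro z hz hd
    refine ⟨?_, ?_⟩
    · rw [eq_div_iff hd, mul_comm, hf.den_mul_log hg hfg z hz]
    · rw [← mul_right_inj' hd, hf.den_mul_id_mul_deriv_log hn hg hfg z hz, mul_sub,
        mul_div_cancel₀ _ hd, mul_comm (n : ℂ)]
  refine ⟨h0, hfin, hform, fun z hz => ?_⟩
  have hz' : Krzyz.disc ∈ 𝓝 z := Krzyz.isOpen_disc.mem_nhds hz
  have hev : ∀ᶠ w in 𝓝[≠] z, w ∈ Krzyz.disc ∧ Krzyz.den n f w ≠ 0 := by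
    -- The zeros other than z form a finite, hence closed, set missing z, so a punctured
    -- neighbourhood of z is free of zeros.
    have hclosed := (hfin.sdiff (t := {z})).isClosed
    filter_upwards [mem_nhdsWithin_of_mem_nhds hz', self_mem_nhdsWithin,
      mem_nhdsWithin_of_mem_nhds (hclosed.compl_mem_nhds fun h => h.2 rfl)] with w h1 h2 h3
    exact ⟨h1, fun h => h3 ⟨h, h2⟩⟩
  have hd' : ContinuousAt (deriv g) z :=
    (hg.deriv Krzyz.isOpen_disc).continuousOn.continuousAt hz'
  refine ⟨?_, ?_⟩
  · refine Tendsto.congr' (hev.mono fun w hw => (hform w hw.1 hw.2).1) ?_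
    exact (hg.continuousOn.continuousAt hz').tendsto.mono_left nhdsWithin_le_nhds
  · refine Tendsto.congr' (hev.mono fun w hw => (hform w hw.1 hw.2).2) ?_
    exact (continuousAt_id.mul hd').tendsto.mono_left nhdsWithin_le_nhds
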